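/- Let $L$ be a $3$-Engel Lie algebra over a field $K$ of characteristic $5$, that is, $[[[a,b],b],b]=0$ for all $a,b\in L$. If the automorphism group $\mathrm{Aut}(L)$ has only finitely many orbits in its componentwise action on $L^4=L\times L\times L\times L$, then $L$ is nilpotent. This holds both when $\mathrm{Aut}(L)$ is the group of $K$-linear Lie algebra automorphisms of $L$ and when it is the (possibly larger) group of all automorphisms of the Lie ring $(L,+,[\cdot,\cdot])$. In particular, every $\omega$-categorical Lie algebra $L$ over $\mathbb{F}_5$ satisfying $[[[x,y],y],y]=0$ for all $x,y\in L$ is nilpotent. Here $L$ is $\omega$-categorical if its complete first-order theory in the language $\{+,[\cdot,\cdot],0\}$ of Lie rings has a unique countable model up to isomorphism (for infinite $L$: a unique countably infinite model; every finite $L$ is $\omega$-categorical). -/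

import Mathlib

/-- A Lie ring (or Lie algebra) is `n`-Engel if `[a, b, …, b] = 0` (left-normed bracket, with `n`
occurrences of `b`) for all elements `a`, `b`. -/
def IsNEngel (n : ℕ) (L : Type*) [LieRing L] : Prop :=
  ∀ a b : L, (fun x : L => ⁅x, b⁆)^[n] a = 0

/-- Two `n`-tuples of elements of an `R`-Lie algebra `L` are equivalent if they lie in the same
orbit of the componentwise action on `Lⁿ` of the group of `R`-linear Lie automorphisms of `L`.
For `R = ℤ` this is the group of all automorphisms of the Lie ring `L`. -/
def autOrbitSetoid (R L : Type*) [CommRing R] [LieRing L] [LieAlgebra R L] (n : ℕ) :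
    Setoid (Fin n → L) where
  r x y := ∃ σ : L ≃ₗ⁅R⁆ L, ∀ i, σ (x i) = y i
  iseqv :=
    { refl := fun _ => ⟨LieEquiv.refl, fun _ => rfl⟩
      symm := by
        rintro x y ⟨σ, h⟩
        exact ⟨σ.symm, fun i => by rw [← h i, LieEquiv.symm_apply_apply]⟩
      trans := by
        rintro x y z ⟨σ, h⟩ ⟨τ, k⟩
        exact ⟨σ.trans τ, fun i => by rw [LieEquiv.trans_apply, h i, k i]⟩ }

/-- The group of `R`-linear Lie automorphisms of `L` has finitely many orbits on `Lⁿ`. -/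
def HasFinitelyManyAutOrbits (R L : Type*) [CommRing R] [LieRing L] [LieAlgebra R L]
    (n : ℕ) : Prop :=
  Finite (Quotient (autOrbitSetoid R L n))

/-- The function symbols of the language `{+, [·,·], 0}` of Lie rings. -/
inductive LieRingFunc : ℕ → Type
  | zero : LieRingFunc 0
  | add : LieRingFunc 2
  | bracket : LieRingFunc 2

/-- The first-order language `{+, [·,·], 0}` of Lie rings. -/
def lieRingLanguage : FirstOrder.Language.{0, 0} where
  Functions := LieRingFunc
  Relations := fun _ => Empty

/-- Every Lie ring is a structure for the language of Lie rings. -/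
instance lieRingStructure (L : Type*) [LieRing L] : lieRingLanguage.Structure L where
  funMap {_} f :=
    match f with
    | LieRingFunc.zero => fun _ => 0
    | LieRingFunc.add => fun v => v 0 + v 1
    | LieRingFunc.bracket => fun v => ⁅v 0, v 1⁆
  RelMap r := nomatch r

/-- A Lie ring `L` is `ω`-categorical if its complete first-order theory has, up to isomorphism,
at most one countably infinite model. By Löwenheim–Skolem there is exactly one when `L` is
infinite; when `L` is finite there is none, and `L` itself is then the only model of its theory.
Every countable model has an isomorphic copy in `Type`, so it suffices to consider models there. -/
def IsOmegaCategorical (L : Type*) [LieRing L] : Prop :=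
  Cardinal.Categorical Cardinal.aleph0.{0} (lieRingLanguage.completeTheory L)

/-! In characteristic 5 the 3-Engel law forces every `adSq a` to commute with all `ad y`
(`IsNEngel.adSq_lie`). These operators therefore lie in the centroid; they commute with one another
and have square zero. Modulo their images `L` has class at most 2, so `L` is nilpotent as soon as
all products of some fixed number of them vanish (`IsNEngel.isNilpotent_of_adSqProd_eq_zero`).

If `L` is not nilpotent, arbitrarily long products are nonzero on some `⁅u, v⁆`. From the factors
one builds (`exists_square_zero_chain`) elements `ζ`, `α`, `β` of the commutative ring they
generate, such that the quadruple `α v`, `β v`, `ζ u`, `f` satisfies `EngelChain` for `n + 1` but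
not for `n`. Since `EngelChain` is invariant under automorphisms and monotone in `n`, there are
infinitely many orbits on quadruples.

It is also definable for each `n`, so a non-nilpotent infinite `L` has a strictly increasing
sequence of definable sets of quadruples. This contradicts `ω`-categoricity, by the relevant half of
the Ryll-Nardzewski theorem, obtained by omitting types. -/

/-! ### Squares of inner derivations and nilpotency. -/

section ThreeEngel

variable {L : Type*} [LieRing L]

/-- The operator `x ↦ ⁅a, ⁅a, x⁆⁆`. -/
def adSq (a : L) : Module.End ℤ L := LieAlgebra.ad ℤ L a * LieAlgebra.ad ℤ L a

theorem adSq_apply (a x : L) : adSq a x = ⁅a, ⁅a, x⁆⁆ := rfl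

theorem lie_lie_self_eq_adSq (a x : L) : ⁅⁅x, a⁆, a⁆ = adSq a x := by
  rw [adSq_apply, ← lie_skew a ⁅a, x⁆, ← lie_skew x a, neg_lie]

theorem IsNEngel.lie_lie_lie_self (h : IsNEngel 3 L) (a x : L) : ⁅a, ⁅a, ⁅a, x⁆⁆⁆ = 0 := by
  have := h x a
  simp only [Function.iterate_succ, Function.iterate_zero, Function.comp, id] at this
  rw [lie_lie_self_eq_adSq, adSq_apply, ← lie_skew x a, lie_neg, lie_neg, neg_eq_zero] at this
  exact this

/-- The cubes of `ad (a + y)` and `ad (a - y)` differ by twice the part linear in `y`, because the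
cube of `ad y` vanishes; 2 is inverted by `-4 = 1` modulo 5. -/
theorem IsNEngel.linearized (h : IsNEngel 3 L) (h5 : ∀ x : L, (5 : ℤ) • x = 0) (a y x : L) :
    ⁅a, ⁅a, ⁅y, x⁆⁆⁆ + ⁅a, ⁅y, ⁅a, x⁆⁆⁆ + ⁅y, ⁅a, ⁅a, x⁆⁆⁆ = 0 := by
  have h1 := h.lie_lie_lie_self (a + y) x
  have h2 := h.lie_lie_lie_self (a - y) x
  have h3 := h.lie_lie_lie_self a x
  have h4 := h.lie_lie_lie_self y x
  simp only [add_lie, lie_add, sub_lie, lie_sub, h3, h4] at h1 h2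
  have e := h5 (⁅a, ⁅a, ⁅y, x⁆⁆⁆ + ⁅a, ⁅y, ⁅a, x⁆⁆⁆ + ⁅y, ⁅a, ⁅a, x⁆⁆⁆)
  linear_combination (norm := module) e - (2 : ℤ) • h1 + (2 : ℤ) • h2

/-- In a `3`-Engel Lie ring of characteristic `5` the squares of inner derivations are linear over
the adjoint action. -/
theorem IsNEngel.adSq_lie (h : IsNEngel 3 L) (h5 : ∀ x : L, (5 : ℤ) • x = 0) (a y x : L) :
    adSq a ⁅y, x⁆ = ⁅y, adSq a x⁆ := by
  simp only [adSq_apply]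
  have h1 := h.linearized h5 a y x
  have h2 := h.linearized h5 a x y
  have e1 : ⁅a, ⁅a, ⁅x, y⁆⁆⁆ = -⁅a, ⁅a, ⁅y, x⁆⁆⁆ := by rw [← lie_skew x y, lie_neg, lie_neg]
  have e2 : ⁅a, ⁅x, ⁅a, y⁆⁆⁆ = -⁅a, ⁅a, ⁅y, x⁆⁆⁆ + ⁅a, ⁅y, ⁅a, x⁆⁆⁆ := by
    rw [← lie_skew x, lie_lie, lie_neg, lie_sub, neg_sub, sub_eq_neg_add]
  have e3 : ⁅x, ⁅a, ⁅a, y⁆⁆⁆ =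
      -⁅a, ⁅a, ⁅y, x⁆⁆⁆ + (2 : ℤ) • ⁅a, ⁅y, ⁅a, x⁆⁆⁆ - ⁅y, ⁅a, ⁅a, x⁆⁆⁆ := by
    rw [← lie_skew x, lie_lie, lie_lie a y x, lie_lie a y ⁅a, x⁆, lie_sub]
    module
  rw [e1, e2, e3] at h2
  have f1 := h5 ⁅a, ⁅a, ⁅y, x⁆⁆⁆
  have f2 := h5 ⁅y, ⁅a, ⁅a, x⁆⁆⁆
  -- Write `A`, `B`, `C` for the three terms of `h1`. Then `h2` reads `-3A + 3B - C = 0`, and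
  -- eliminating `B` leaves `6A + 4C`, which is `A - C` in characteristic 5.
  linear_combination (norm := module) (3 : ℤ) • h1 - h2 - f1 - f2

theorem lie_lie_add_lie_lie (a b u : L) :
    ⁅a, ⁅b, u⁆⁆ + ⁅b, ⁅a, u⁆⁆ = adSq (a + b) u - adSq a u - adSq b u := by
  simp only [adSq_apply, add_lie, lie_add]
  abel

/-- Modulo the squares of inner derivations a Lie ring of characteristic `5` is `2`-Engel, hence
nilpotent of class at most `2`. -/
theorem lie_lie_mem_span_adSq (h5 : ∀ x : L, (5 : ℤ) • x = 0) (a b u : L) :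
    ⁅a, ⁅b, u⁆⁆ ∈ Submodule.span ℤ {x : L | ∃ c w : L, x = adSq c w} := by
  set J := Submodule.span ℤ {x : L | ∃ c w : L, x = adSq c w}
  have hq : ∀ c w : L, adSq c w ∈ J := fun c w => Submodule.subset_span ⟨c, w, rfl⟩
  have hp : ∀ a b u : L, ⁅a, ⁅b, u⁆⁆ + ⁅b, ⁅a, u⁆⁆ ∈ J := fun a b u => by
    rw [lie_lie_add_lie_lie]
    exact J.sub_mem (J.sub_mem (hq _ _) (hq _ _)) (hq _ _)
  have h1 := hp a b u
  have h2 := hp u a b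
  have j := lie_jacobi a b u
  have e1 : ⁅b, ⁅u, a⁆⁆ = -⁅b, ⁅a, u⁆⁆ := by rw [← lie_skew u a, lie_neg]
  have e2 : ⁅a, ⁅u, b⁆⁆ = -⁅a, ⁅b, u⁆⁆ := by rw [← lie_skew u b, lie_neg]
  rw [e1] at j
  rw [e2] at h2
  -- Modulo `J` the triple bracket is alternating, so Jacobi says that three times it lies in `J`;
  -- the factor 2 inverts 3 modulo 5.
  have e : ⁅a, ⁅b, u⁆⁆ = (2 : ℤ) • ((⁅a, ⁅b, u⁆⁆ + ⁅b, ⁅a, u⁆⁆) -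
      (⁅u, ⁅a, b⁆⁆ + -⁅a, ⁅b, u⁆⁆)) := by
    linear_combination (norm := module) (2 : ℤ) • j - h5 ⁅a, ⁅b, u⁆⁆
  rw [e]
  exact J.smul_mem _ (J.sub_mem h1 h2)

/-- The composite of the operators `adSq a` for `a` in a list. -/
def adSqProd (l : List L) : Module.End ℤ L := (l.map adSq).prod

theorem adSqProd_nil (x : L) : adSqProd [] x = x := rfl

theorem adSqProd_cons (a : L) (l : List L) (x : L) :
    adSqProd (a :: l) x = adSq a (adSqProd l x) := by
  simp [adSqProd]

theorem adSqProd_append (l₁ l₂ : List L) (x : L) :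
    adSqProd (l₁ ++ l₂) x = adSqProd l₁ (adSqProd l₂ x) := by
  simp [adSqProd]

theorem IsNEngel.adSqProd_lie (h : IsNEngel 3 L) (h5 : ∀ x : L, (5 : ℤ) • x = 0) (l : List L)
    (y x : L) : adSqProd l ⁅y, x⁆ = ⁅y, adSqProd l x⁆ := by
  induction l with
  | nil => rfl
  | cons a l ih => rw [adSqProd_cons, adSqProd_cons, ih, h.adSq_lie h5]

theorem LieSubmodule.lie_top_lie_top_le {N N' : LieSubmodule ℤ L L}
    (h : ∀ a b : L, ∀ x ∈ N, ⁅a, ⁅b, x⁆⁆ ∈ N') :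
    ⁅(⊤ : LieIdeal ℤ L), ⁅(⊤ : LieIdeal ℤ L), N⁆⁆ ≤ N' := by
  rw [LieSubmodule.lie_le_iff]
  intro a _ m hm
  rw [← LieSubmodule.mem_toSubmodule, LieSubmodule.lieIdeal_oper_eq_linear_span'] at hm
  induction hm using Submodule.span_induction with
  | mem x hx =>
    obtain ⟨b, -, n, hn, rfl⟩ := hx
    exact h a b n hn
  | zero => simp
  | add x y _ _ hx hy => rw [lie_add]; exact N'.add_mem hx hy
  | smul r x _ hx => rw [lie_smul]; exact N'.smul_mem r hx

/-- The `k`-fold products span an ideal `J k`, since they commute with `ad`. Two further brackets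
slip past the product and create one more factor `adSq c`, so the lower central series gains one
factor every two steps. -/
theorem IsNEngel.isNilpotent_of_adSqProd_eq_zero (h : IsNEngel 3 L)
    (h5 : ∀ x : L, (5 : ℤ) • x = 0) (n : ℕ)
    (hn : ∀ l : List L, l.length = n → ∀ x : L, adSqProd l x = 0) : LieRing.IsNilpotent L := by
  let S : ℕ → Set L := fun k => {x | ∃ l : List L, l.length = k ∧ ∃ u, x = adSqProd l u}
  let J : ℕ → LieSubmodule ℤ L L := fun k =>
    { Submodule.span ℤ (S k) with
      lie_mem := by
        intro a m hm
        change m ∈ Submodule.span ℤ (S k) at hm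
        change ⁅a, m⁆ ∈ Submodule.span ℤ (S k)
        induction hm using Submodule.span_induction with
        | mem x hx =>
          obtain ⟨l, hl, u, rfl⟩ := hx
          exact Submodule.subset_span ⟨l, hl, ⁅a, u⁆, (h.adSqProd_lie h5 l a u).symm⟩
        | zero => simp
        | add x y _ _ hx hy => rw [lie_add]; exact Submodule.add_mem _ hx hy
        | smul r x _ hx => rw [lie_smul]; exact Submodule.smul_mem _ r hx }
  have hJ : ∀ k x, x ∈ J k ↔ x ∈ Submodule.span ℤ (S k) := fun k x => Iff.rfl
  have hle : ∀ k, LieModule.lowerCentralSeries ℤ L L (2 * k) ≤ J k := by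
    intro k
    induction k with
    | zero => exact fun x _ => Submodule.subset_span ⟨[], rfl, x, rfl⟩
    | succ k ih =>
      rw [show 2 * (k + 1) = 2 * k + 1 + 1 by ring, LieModule.lowerCentralSeries_succ,
        LieModule.lowerCentralSeries_succ]
      refine LieSubmodule.lie_top_lie_top_le fun a b x hx => ?_
      have hx' := ih hx
      clear hx
      rw [hJ] at hx' ⊢
      induction hx' using Submodule.span_induction with
      | mem x hx =>
        obtain ⟨l, hl, u, rfl⟩ := hx
        rw [← h.adSqProd_lie h5, ← h.adSqProd_lie h5]
        have hu := lie_lie_mem_span_adSq h5 a b u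
        generalize ⁅a, ⁅b, u⁆⁆ = y at hu ⊢
        induction hu using Submodule.span_induction with
        | mem y hy =>
          obtain ⟨c, w, rfl⟩ := hy
          refine Submodule.subset_span ⟨l ++ [c], by simp [hl], w, ?_⟩
          rw [adSqProd_append, adSqProd_cons, adSqProd_nil]
        | zero => simp
        | add x y _ _ hx hy => rw [map_add]; exact Submodule.add_mem _ hx hy
        | smul r x _ hx => rw [map_smul]; exact Submodule.smul_mem _ r hx
      | zero => simp
      | add x y _ _ hx hy => rw [lie_add, lie_add]; exact Submodule.add_mem _ hx hy
      | smul r x _ hx => rw [lie_smul, lie_smul]; exact Submodule.smul_mem _ r hx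
  refine (LieModule.isNilpotent_iff_int L L).2 ⟨2 * n, ?_⟩
  refine le_bot_iff.1 ((hle n).trans fun x hx => ?_)
  rw [hJ] at hx
  rw [LieSubmodule.mem_bot]
  induction hx using Submodule.span_induction with
  | mem x hx =>
    obtain ⟨l, hl, u, rfl⟩ := hx
    exact hn l hl u
  | zero => rfl
  | add x y _ _ hx hy => rw [hx, hy, add_zero]
  | smul r x _ hx => rw [hx, smul_zero]

end ThreeEngel

/-! ### Identities in a commutative ring with square-zero elements. -/

section SquareZero

variable {A : Type*} [CommRing A]

/-- The combinatorial identities behind the obstruction to finitely many orbits, for families of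
elements with square zero in a commutative ring. -/
theorem exists_square_zero_chain (s x w : ℕ → A) (hs : ∀ i, s i * s i = 0)
    (hx : ∀ i, x i * x i = 0) (hw : ∀ i, w i * w i = 0) (k : ℕ) (hk : 0 < k) :
    ∃ ζ α β : A, w 0 * ζ * α = 0 ∧ (∀ i < k, w (i + 1) * ζ * α = w i * ζ * β) ∧
      (∀ j, 0 < j → j < k → ζ * s j * α = ζ * s (j + 1) * β) ∧
      s k * (w k * ζ * α) = ∏ i ∈ Finset.range (k + 2), s i * x i * w i := by
  classical
  set p : ℕ → A := fun i => s i * x i * w i with hp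
  set R := Finset.range (k + 2) with hR
  -- `z i` is the full product without `s i`, `x i`, `w i`, `s (i + 1)`, so every other factor kills
  -- it; `μ j` is the full product without `s j` alone.
  set z : ℕ → A := fun i => (∏ l ∈ (R.erase i).erase (i + 1), p l) * (x (i + 1) * w (i + 1)) with hz
  set μ : ℕ → A := fun j => (∏ l ∈ R.erase j, p l) * (x j * w j) with hμ
  have hdvd : ∀ i ≤ k, ∀ l ≤ k + 1, l ≠ i → x l ∣ z i ∧ w l ∣ z i ∧ (l ≠ i + 1 → s l ∣ z i) := by
    intro i hi l hl hli
    by_cases h : l = i + 1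
    · subst h
      exact ⟨Dvd.intro_left ((∏ l ∈ (R.erase i).erase (i + 1), p l) * w (i + 1))
          (by simp only [hz]; ring),
        Dvd.intro_left ((∏ l ∈ (R.erase i).erase (i + 1), p l) * x (i + 1))
          (by simp only [hz]; ring),
        fun h => absurd rfl h⟩
    · have : p l ∣ z i := Dvd.dvd.mul_right (Finset.dvd_prod_of_mem p (by simp [hR, h, hli]; omega)) _
      exact ⟨(Dvd.intro (s l * w l) (by simp only [hp]; ring)).trans this,
        (Dvd.intro (s l * x l) (by simp only [hp]; ring)).trans this,
        fun _ => (Dvd.intro (x l * w l) (by simp only [hp]; ring)).trans this⟩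
  have hzero : ∀ a b : A, a * a = 0 → a ∣ b → b * a = 0 := by
    rintro a _ ha ⟨c, rfl⟩
    rw [mul_right_comm, ha, zero_mul]
  have zx : ∀ i ≤ k, ∀ l ≤ k + 1, l ≠ i → z i * x l = 0 := fun i hi l hl h =>
    hzero _ _ (hx l) (hdvd i hi l hl h).1
  have zw : ∀ i ≤ k, ∀ l ≤ k + 1, l ≠ i → z i * w l = 0 := fun i hi l hl h =>
    hzero _ _ (hw l) (hdvd i hi l hl h).2.1
  have zs : ∀ i ≤ k, ∀ l ≤ k + 1, l ≠ i → l ≠ i + 1 → z i * s l = 0 := fun i hi l hl h h' =>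
    hzero _ _ (hs l) ((hdvd i hi l hl h).2.2 h')
  have zμ : ∀ i ≤ k, z i * s (i + 1) * x i * w i = μ i := by
    intro i hi
    have : i + 1 ∈ R.erase i := by simp [hR]; omega
    simp only [hμ, hz]
    rw [← Finset.prod_erase_mul _ _ this]
    simp only [hp]
    ring
  have zμ' : ∀ i ≤ k, z i * s i * x i * w i = μ (i + 1) := by
    intro i hi
    have : i ∈ R.erase (i + 1) := by simp [hR]; omega
    simp only [hμ, hz]
    rw [← Finset.prod_erase_mul _ _ this, Finset.erase_right_comm]
    simp only [hp]
    ring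
  have sμ : s k * μ k = ∏ i ∈ R, p i := by
    have : k ∈ R := by simp [hR]
    rw [← Finset.prod_erase_mul _ _ this]
    simp only [hμ, hp]
    ring
  -- On `z i`, `β` restores `s i * x i` and, for `0 < i`, `α` restores `s (i + 1) * x i`. The sum
  -- `α` has no term with `x 0`, whence `z 0 * α = 0`, the start of the chain.
  set ζ := ∑ i ∈ Finset.range (k + 1), z i with hζ
  set α := ∑ i ∈ Finset.range k, s (i + 2) * x (i + 1) with hα
  set β := ∑ i ∈ Finset.range (k + 1), s i * x i with hβ
  have wζ : ∀ i ≤ k, w i * ζ = w i * z i := by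
    intro i hi
    rw [hζ, Finset.mul_sum]
    refine Finset.sum_eq_single_of_mem i (by simp; omega) fun l hl hli => ?_
    rw [mul_comm, zw l (by simp at hl; omega) i (by omega) (Ne.symm hli)]
  have zα0 : z 0 * α = 0 := by
    rw [hα, Finset.mul_sum]
    refine Finset.sum_eq_zero fun l hl => ?_
    rw [mul_comm (s _), ← mul_assoc, zx 0 (by omega) (l + 1) (by simp at hl; omega) (by omega),
      zero_mul]
  have zα : ∀ i < k, z (i + 1) * α = z (i + 1) * s (i + 2) * x (i + 1) := by
    intro i hi
    rw [hα, Finset.mul_sum, mul_assoc]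
    refine Finset.sum_eq_single_of_mem i (by simpa using hi) fun l hl hli => ?_
    rw [mul_comm (s _), ← mul_assoc,
      zx (i + 1) (by omega) (l + 1) (by simp at hl; omega) (by omega), zero_mul]
  have zβ : ∀ i ≤ k, z i * β = z i * s i * x i := by
    intro i hi
    rw [hβ, Finset.mul_sum, mul_assoc]
    refine Finset.sum_eq_single_of_mem i (by simp; omega) fun l hl hli => ?_
    rw [mul_comm (s _), ← mul_assoc, zx i hi l (by simp at hl; omega) hli, zero_mul]
  have wα : ∀ i < k, w (i + 1) * ζ * α = μ (i + 1) := by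
    intro i hi
    rw [wζ _ (by omega), mul_assoc, zα i hi, ← zμ (i + 1) (by omega)]
    ring
  refine ⟨ζ, α, β, ?_, ?_, ?_, ?_⟩
  · rw [wζ 0 (by omega), mul_assoc, zα0, mul_zero]
  · intro i hi
    rw [wα i hi, wζ i (by omega), mul_assoc, zβ i (by omega), ← zμ' i (by omega)]
    ring
  · intro j hj hjk
    obtain ⟨j, rfl⟩ : ∃ i, j = i + 1 := ⟨j - 1, by omega⟩
    -- Besides `z (j + 1)` only the neighbour `z j` survives `s (j + 1)`, and `α` then supplies a
    -- second factor `s (j + 1)`. The same happens in `e2` with `z (j + 2)` and `β`.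
    have e1 : ζ * s (j + 1) * α = z (j + 1) * s (j + 1) * α := by
      rw [hζ, Finset.sum_mul, Finset.sum_mul]
      refine Finset.sum_eq_single_of_mem (j + 1) (by simp; omega) fun l hl hli => ?_
      simp at hl
      by_cases h : l = j
      · subst h
        rcases l with _ | l
        · rw [mul_right_comm, zα0, zero_mul]
        · rw [mul_right_comm, zα l (by omega)]
          linear_combination z (l + 1) * x (l + 1) * hs (l + 2)
      · rw [zs l (by omega) (j + 1) (by omega) (by omega) (by omega), zero_mul]
    have e2 : ζ * s (j + 1 + 1) * β = z (j + 1) * s (j + 1 + 1) * β := by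
      rw [hζ, Finset.sum_mul, Finset.sum_mul]
      refine Finset.sum_eq_single_of_mem (j + 1) (by simp; omega) fun l hl hli => ?_
      simp at hl
      by_cases h : l = j + 2
      · subst h
        rw [mul_right_comm, zβ _ (by omega)]
        linear_combination z (j + 2) * x (j + 2) * hs (j + 2)
      · rw [zs l (by omega) (j + 1 + 1) (by omega) (by omega) (by omega), zero_mul]
    rw [e1, e2, mul_right_comm, zα j (by omega), mul_right_comm _ _ β, zβ _ (by omega)]
    ring
  · obtain ⟨k, rfl⟩ : ∃ i, k = i + 1 := ⟨k - 1, by omega⟩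
    rw [wα k (by omega), sμ]

end SquareZero

/-! ### Engel chains and infinitely many orbits. -/

section ThreeEngel

variable {L : Type*} [LieRing L]

/-- `EngelChain y₁ y₂ z n f` says that there are `f₀, …, fₙ = f` in `{⁅⁅z, a⁆, a⁆ | a ∈ L}` with
`⁅f₀, y₁⁆ = 0` and `⁅fᵢ, y₂⁆ = ⁅fᵢ₊₁, y₁⁆` for all `i < n`. -/
def EngelChain (y₁ y₂ z : L) : ℕ → L → Prop
  | 0, f => (∃ a, f = ⁅⁅z, a⁆, a⁆) ∧ ⁅f, y₁⁆ = 0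
  | n + 1, f => (∃ a, f = ⁅⁅z, a⁆, a⁆) ∧ ∃ f', EngelChain y₁ y₂ z n f' ∧ ⁅f', y₂⁆ = ⁅f, y₁⁆

theorem EngelChain.exists_eq {y₁ y₂ z f : L} {n : ℕ} (h : EngelChain y₁ y₂ z n f) :
    ∃ a, f = ⁅⁅z, a⁆, a⁆ := by
  cases n with
  | zero => exact h.1
  | succ n => exact h.1

theorem engelChain_zero_right (y₁ y₂ z : L) (n : ℕ) : EngelChain y₁ y₂ z n 0 := by
  induction n with
  | zero => exact ⟨⟨0, by simp⟩, by simp⟩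
  | succ n ih => exact ⟨⟨0, by simp⟩, 0, ih, by simp⟩

/-- A chain can be lengthened at its beginning by `0`. -/
theorem EngelChain.succ {y₁ y₂ z f : L} {n : ℕ} (h : EngelChain y₁ y₂ z n f) :
    EngelChain y₁ y₂ z (n + 1) f := by
  induction n generalizing f with
  | zero => exact ⟨h.1, 0, engelChain_zero_right _ _ _ _, by rw [zero_lie, h.2]⟩
  | succ n ih =>
    obtain ⟨hf, f', hf', e⟩ := h
    exact ⟨hf, f', ih hf', e⟩

theorem EngelChain.mono {y₁ y₂ z f : L} {m n : ℕ} (hmn : m ≤ n) (h : EngelChain y₁ y₂ z m f) :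
    EngelChain y₁ y₂ z n f := by
  induction hmn with
  | refl => exact h
  | step _ ih => exact ih.succ

theorem EngelChain.map {y₁ y₂ z f : L} {n : ℕ} (σ : L ≃ₗ⁅ℤ⁆ L) (h : EngelChain y₁ y₂ z n f) :
    EngelChain (σ y₁) (σ y₂) (σ z) n (σ f) := by
  induction n generalizing f with
  | zero =>
    obtain ⟨⟨a, rfl⟩, e⟩ := h
    exact ⟨⟨σ a, by rw [LieEquiv.map_lie, LieEquiv.map_lie]⟩, by rw [← LieEquiv.map_lie, e, map_zero]⟩
  | succ n ih =>
    obtain ⟨⟨a, rfl⟩, f', hf', e⟩ := h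
    exact ⟨⟨σ a, by rw [LieEquiv.map_lie, LieEquiv.map_lie]⟩, σ f', ih hf', by rw [← LieEquiv.map_lie, e, LieEquiv.map_lie]⟩

theorem IsNEngel.adSq_mul_self (h : IsNEngel 3 L) (a : L) : adSq a * adSq a = 0 := by
  ext x
  exact (congrArg (fun y => ⁅a, y⁆) (h.lie_lie_lie_self a x)).trans (lie_zero a)

theorem IsNEngel.adSq_mul_comm (h : IsNEngel 3 L) (h5 : ∀ x : L, (5 : ℤ) • x = 0) (a b : L) :
    adSq a * adSq b = adSq b * adSq a := by
  ext x
  simp only [Module.End.mul_apply, adSq_apply b, h.adSq_lie h5]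

open scoped IsMulCommutative in
/-- In a non-nilpotent `3`-Engel Lie ring of characteristic `5` there are chains which cannot be
replaced by shorter ones. -/
theorem IsNEngel.exists_engelChain (h : IsNEngel 3 L) (h5 : ∀ x : L, (5 : ℤ) • x = 0)
    (hL : ¬ LieRing.IsNilpotent L) (n : ℕ) :
    ∃ y₁ y₂ z f : L, EngelChain y₁ y₂ z (n + 1) f ∧ ¬ EngelChain y₁ y₂ z n f := by
  -- One extra factor `adSq c` is sacrificed so that the rest acts on a bracket. The rest consists
  -- of `n + 3` triples, as needed for `k = n + 1`.
  have key : ∃ (a : ℕ → L) (u v : L),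
      ((List.range (3 * (n + 3))).map fun i => adSq (a i)).prod ⁅u, v⁆ ≠ 0 := by
    by_contra! hc
    refine hL (h.isNilpotent_of_adSqProd_eq_zero h5 (3 * (n + 3) + 1) fun l hl x => ?_)
    cases l with
    | nil => simp at hl
    | cons c l =>
      have hl : l.length = 3 * (n + 3) := by simpa using hl
      rw [adSqProd_cons, adSq_apply, h.adSqProd_lie h5 l c x |>.symm, ← h.adSqProd_lie h5,
        ← lie_skew, map_neg, neg_eq_zero]
      have := hc (fun i => l.getD i 0) ⁅c, x⁆ c
      rw [← hl] at this
      convert this using 2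
      rw [adSqProd]
      congr 1
      refine List.ext_getElem (by simp) fun i h1 h2 => ?_
      simp at h1
      simp [h1]
  obtain ⟨a, u, v, hne⟩ := key
  set Q : Set (Module.End ℤ L) := Set.range adSq
  have hcomm : ∀ x ∈ Q, ∀ y ∈ Q, x * y = y * x := by
    rintro _ ⟨a, rfl⟩ _ ⟨b, rfl⟩
    exact h.adSq_mul_comm h5 a b
  have := Subring.isMulCommutative_closure hcomm
  let q : ℕ → Subring.closure Q := fun i => ⟨adSq (a i), Subring.subset_closure ⟨a i, rfl⟩⟩
  have hq : ∀ i, q i * q i = 0 := fun i => Subtype.ext (h.adSq_mul_self (a i))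
  have hlie : ∀ (c : Subring.closure Q) (y x : L), c.1 ⁅y, x⁆ = ⁅y, c.1 x⁆ := by
    rintro ⟨c, hc⟩ y x
    change c ⁅y, x⁆ = ⁅y, c x⁆
    induction hc using Subring.closure_induction generalizing x with
    | mem c hc => obtain ⟨b, rfl⟩ := hc; exact h.adSq_lie h5 b y x
    | zero => simp
    | one => rfl
    | add c d _ _ hc hd => simp [hc, hd]
    | neg c _ hc => simp [hc]
    | mul c d _ _ hc hd => rw [Module.End.mul_apply, hd, hc]; rfl
  have hlie' : ∀ (c : Subring.closure Q) (y x : L), c.1 ⁅y, x⁆ = ⁅c.1 y, x⁆ := by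
    intro c y x
    rw [← lie_skew, map_neg, hlie, lie_skew]
  have hmul : ∀ (c d : Subring.closure Q) (x : L), c.1 (d.1 x) = (c * d).1 x := fun _ _ _ => rfl
  obtain ⟨ζ, α, β, h0, h1, h2, h3⟩ := exists_square_zero_chain (fun i => q (3 * i))
    (fun i => q (3 * i + 1)) (fun i => q (3 * i + 2)) (fun _ => hq _) (fun _ => hq _)
    (fun _ => hq _) (n + 1) n.succ_pos
  have hprod : (∏ i ∈ Finset.range (n + 1 + 2), q (3 * i) * q (3 * i + 1) * q (3 * i + 2) :
      Subring.closure Q).1 = ((List.range (3 * (n + 3))).map fun i => adSq (a i)).prod := by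
    generalize n + 1 + 2 = m
    have : ∀ m, (∏ i ∈ Finset.range m, q (3 * i) * q (3 * i + 1) * q (3 * i + 2) :
      Subring.closure Q).1 = ((List.range (3 * m)).map fun i => adSq (a i)).prod := by
      intro m
      induction m with
      | zero => rfl
      | succ m ih =>
        rw [Finset.prod_range_succ, Nat.mul_succ, List.range_succ, List.range_succ,
          List.range_succ]
        simp only [List.map_append, List.prod_append, ← ih]
        simp [q]
        rfl
    exact this m
  set s : ℕ → Subring.closure Q := fun i => q (3 * i) with hs
  set w : ℕ → Subring.closure Q := fun i => q (3 * i + 2) with hw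
  have chain : ∀ i ≤ n + 1, EngelChain (α.1 v) (β.1 v) (ζ.1 u) i ((w i * ζ).1 u) := by
    intro i
    have hmem : ∀ i, ∃ b, (w i * ζ).1 u = ⁅⁅ζ.1 u, b⁆, b⁆ := fun i =>
      ⟨a (3 * i + 2), (lie_lie_self_eq_adSq _ _).symm⟩
    have hb : ∀ c : Subring.closure Q, ∀ i, ⁅(w i * ζ).1 u, c.1 v⁆ = (w i * ζ * c).1 ⁅u, v⁆ := by
      intro c i
      rw [← hlie' (w i * ζ), ← hlie c, hmul]
    induction i with
    | zero => exact fun _ => ⟨hmem 0, by rw [hb, h0]; rfl⟩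
    | succ i ih => exact fun hi => ⟨hmem _, _, ih (by omega), by rw [hb, hb, h1 i (by omega)]⟩
  -- This concerns arbitrary chains: each link moves the annihilator from `s j` to `s (j + 1)`. A
  -- chain of length `n` ending in `f` would thus make `s (n + 1)` kill `⁅f, α.1 v⁆`, which is the
  -- nonzero product applied to `⁅u, v⁆`.
  have descend : ∀ m f, EngelChain (α.1 v) (β.1 v) (ζ.1 u) m f → ∀ j, m < j → j ≤ n + 1 →
      (s j).1 ⁅f, α.1 v⁆ = 0 := by
    intro m
    induction m with
    | zero => intro f hf j _ _; rw [hf.2, map_zero]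
    | succ m ih =>
      rintro f ⟨-, f', hf', e⟩ (_ | j) hj hjn
      · omega
      have := ih f' hf' j (by omega) (by omega)
      obtain ⟨b, rfl⟩ := hf'.exists_eq
      have hb : ∀ (c d : Subring.closure Q), c.1 ⁅⁅⁅ζ.1 u, b⁆, b⁆, d.1 v⁆ =
          (ζ * c * d).1 ⁅⁅⁅u, b⁆, b⁆, v⁆ := by
        intro c d
        rw [← hlie d, ← hlie' ζ, ← hlie' ζ, ← hlie' ζ, hmul, hmul]
        congr 2
        ring
      rw [← e, hb, ← h2 j (by omega) (by omega), ← hb, this]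
  refine ⟨α.1 v, β.1 v, ζ.1 u, _, chain (n + 1) le_rfl, fun hc => hne ?_⟩
  have := descend n _ hc (n + 1) (by omega) le_rfl
  rw [← hlie α, ← hlie', hmul, hmul] at this
  rw [← hprod, ← h3, ← this]
  congr 2
  simp only [hs, hw]
  ring

theorem HasFinitelyManyAutOrbits.restrictScalars_int {R : Type*} [CommRing R] [LieAlgebra R L]
    {n : ℕ} (h : HasFinitelyManyAutOrbits R L n) : HasFinitelyManyAutOrbits ℤ L n := by
  unfold HasFinitelyManyAutOrbits at h ⊢
  refine Finite.of_surjective (Quotient.map (sa := autOrbitSetoid R L n)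
    (sb := autOrbitSetoid ℤ L n) id ?_) ?_
  · rintro x y ⟨σ, hσ⟩
    exact ⟨{ σ.toLinearEquiv.toAddEquiv.toIntLinearEquiv with
      map_lie' := fun {x y} => LieEquiv.map_lie σ x y }, hσ⟩
  · rintro ⟨x⟩
    exact ⟨Quotient.mk _ x, rfl⟩

theorem IsNEngel.isNilpotent_of_hasFinitelyManyAutOrbits (h : IsNEngel 3 L)
    (h5 : ∀ x : L, (5 : ℤ) • x = 0) (hfin : HasFinitelyManyAutOrbits ℤ L 4) :
    LieRing.IsNilpotent L := by
  by_contra hL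
  choose y₁ y₂ z f h1 h2 using h.exists_engelChain h5 hL
  unfold HasFinitelyManyAutOrbits at hfin
  obtain ⟨m, n, hmn, e⟩ := Finite.exists_ne_map_eq_of_infinite fun n =>
    (Quotient.mk (autOrbitSetoid ℤ L 4) ![y₁ n, y₂ n, z n, f n])
  wlog hlt : m < n generalizing m n
  · exact this n m hmn.symm e.symm (by omega)
  obtain ⟨σ, hσ⟩ := Quotient.exact e
  have := ((h1 m).map σ).mono (Nat.succ_le_of_lt hlt)
  have e0 := hσ 0
  have e1 := hσ 1
  have e2 := hσ 2
  have e3 := hσ 3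
  simp at e0 e1 e2 e3
  rw [e0, e1, e2, e3] at this
  exact h2 n this

theorem zsmul_five_eq_zero (K : Type*) [Field K] [CharP K 5] [LieAlgebra K L] (x : L) :
    (5 : ℤ) • x = 0 := by
  have : ((5 : ℤ) : K) = 0 := by exact_mod_cast CharP.cast_eq_zero K 5
  rw [← Int.cast_smul_eq_zsmul K, this, zero_smul]

end ThreeEngel

/-! ### Categoricity excludes strictly increasing definable sets. -/

section OmegaCategorical

open FirstOrder.Language Cardinal
open scoped FirstOrder

variable {Λ : FirstOrder.Language.{0, 0}} {M : Type*} [Λ.Structure M]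

theorem FirstOrder.Language.Formula.realize_congr_of_eqOn {α : Type*} [DecidableEq α]
    (φ : Λ.Formula α) {v w : α → M} (h : ∀ a ∈ φ.freeVarFinset, v a = w a) :
    φ.Realize v ↔ φ.Realize w :=
  (BoundedFormula.realize_restrictFreeVar (φ := φ) (f := id) (v := fun a => v a) v
    (fun _ => rfl)).symm.trans
    (BoundedFormula.realize_restrictFreeVar (φ := φ) (f := id) (v := fun a => v a) w
      (fun a => h a a.2))

theorem FirstOrder.Language.Formula.exists_support_bound (φ : Λ.Formula ℕ) :
    ∃ K : ℕ, ∀ v w : ℕ → M, (∀ n < K, v n = w n) → (φ.Realize v ↔ φ.Realize w) := by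
  refine ⟨φ.freeVarFinset.sup id + 1, fun v w h => φ.realize_congr_of_eqOn fun a ha => h a ?_⟩
  exact Nat.lt_succ_of_le (Finset.le_sup (f := id) ha)

/-- Compactness and the Löwenheim–Skolem theorem: a finitely satisfiable set of formulas is realized
in a countable model. -/
theorem exists_countable_model_realize [Countable Λ.Symbols] [Infinite M] {α : Type} [Countable α]
    (p : Set (Λ.Formula α))
    (hp : ∀ s : Finset (Λ.Formula α), ↑s ⊆ p → ∃ v : α → M, ∀ φ ∈ s, φ.Realize v) :
    ∃ (N : Theory.ModelType.{0, 0, 0} (Λ.completeTheory M)) (v : α → N), #N = ℵ₀ ∧ ∀ φ ∈ p, φ.Realize v := by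
  classical
  let T₁ : Λ[[α]].Theory :=
    (Λ.lhomWithConstants α).onTheory (Λ.completeTheory M) ∪ Formula.equivSentence '' p
  have hsat : T₁.IsSatisfiable := by
    rw [Theory.isSatisfiable_iff_isFinitelySatisfiable]
    intro T₀ hT₀
    obtain ⟨v, hv⟩ := hp ((T₀.image Formula.equivSentence.symm).filter (· ∈ p)) (by
      intro φ hφ
      exact (Finset.mem_filter.1 (Finset.mem_coe.1 hφ)).2)
    let : (constantsOn α).Structure M := constantsOn.structure v
    have : M ⊨ (T₀ : Λ[[α]].Theory) := by
      refine ⟨fun σ hσ => ?_⟩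
      rcases hT₀ hσ with h | ⟨φ, hφ, rfl⟩
      · exact ((LHom.onTheory_model (Λ.lhomWithConstants α) (Λ.completeTheory M)).2
          inferInstance).realize_of_mem σ h
      · refine (Formula.realize_equivSentence M φ).2 (hv φ (Finset.mem_filter.2 ⟨?_, hφ⟩))
        exact Finset.mem_image.2 ⟨_, hσ, by simp⟩
    exact Theory.Model.isSatisfiable M
  obtain ⟨N₀⟩ := hsat
  have hred : ∀ N : T₁.ModelType, @Theory.Model Λ N ((Λ.lhomWithConstants α).reduct N)
      (Λ.completeTheory M) := fun N => by
    let : Λ.Structure N := (Λ.lhomWithConstants α).reduct N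
    exact (LHom.onTheory_model (Λ.lhomWithConstants α) (Λ.completeTheory M)).1
      (Theory.Model.mono N.is_model Set.subset_union_left)
  have hinf : ∃ N : T₁.ModelType, Infinite N := by
    refine ⟨N₀, ?_⟩
    let : Λ.Structure N₀ := (Λ.lhomWithConstants α).reduct N₀
    have := hred N₀
    exact ((completeTheory.isComplete Λ M).models_elementarily_equivalent M N₀).infinite
  obtain ⟨N, hN⟩ := Theory.exists_model_card_eq hinf ℵ₀ le_rfl (by
    rw [lift_aleph0, lift_le_aleph0]
    exact mk_le_aleph0_iff.2 inferInstance)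
  let : Λ.Structure N := (Λ.lhomWithConstants α).reduct N
  have := hred N
  refine ⟨Theory.ModelType.of (Λ.completeTheory M) N, fun a => (Λ.con a : N), hN, fun φ hφ => ?_⟩
  exact (Formula.realize_equivSentence N φ).1 (N.is_model.realize_of_mem _ (Or.inr ⟨φ, hφ, rfl⟩))

/-- If there is a strictly increasing sequence of definable sets of `m`-tuples, then there is a
complete type of `m`-tuples which is not isolated. -/
theorem exists_nonisolated_type {m : ℕ} (φ : ℕ → Λ.Formula (Fin m))
    (hmono : ∀ i j, i ≤ j → ∀ v : Fin m → M, (φ i).Realize v → (φ j).Realize v)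
    (hlt : ∀ i, ∃ v : Fin m → M, (φ (i + 1)).Realize v ∧ ¬ (φ i).Realize v) :
    ∃ p : Set (Λ.Formula (Fin m)),
      (∀ s : Finset (Λ.Formula (Fin m)), ↑s ⊆ p → ∃ v : Fin m → M, ∀ χ ∈ s, χ.Realize v) ∧
      ∀ θ : Λ.Formula (Fin m), (∃ v : Fin m → M, θ.Realize v) →
        ∃ χ ∈ p, ∃ v : Fin m → M, θ.Realize v ∧ ¬ χ.Realize v := by
  let atom : Λ.Formula (Fin m) → Prop := fun θ => ∀ χ : Λ.Formula (Fin m),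
    (∀ v : Fin m → M, θ.Realize v → χ.Realize v) ∨ ∀ v : Fin m → M, θ.Realize v → ¬ χ.Realize v
  let S : Set (Set (Fin m → M)) := {s | ∃ θ, atom θ ∧ s = {v | ¬ θ.Realize v}}
  -- If finitely many atoms covered all tuples, two witnesses `v i`, `v j` with `i < j` would share
  -- an atom, yet `φ (i + 1)` separates them.
  have hS : (Filter.generate S).NeBot := by
    refine Filter.generate_neBot_iff.2 fun t ht htfin => ?_
    by_contra hemp
    choose v hv using hlt
    have : ∀ i, ∃ s : t, v i ∉ s.1 := fun i => by
      by_contra! hc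
      exact hemp ⟨v i, fun s hs => hc ⟨s, hs⟩⟩
    choose s hs using this
    have := htfin.to_subtype
    obtain ⟨i, j, hij, e⟩ := Finite.exists_ne_map_eq_of_infinite s
    wlog hlt : i < j generalizing i j
    · exact this j i hij.symm e.symm (by omega)
    obtain ⟨θ, hθ, hsθ⟩ := ht (s i).2
    have hi := hs i
    have hj := hs j
    rw [← e] at hj
    rw [hsθ] at hi hj
    simp only [Set.mem_ofPred_eq, not_not] at hi hj
    rcases hθ (φ (i + 1)) with h | h
    · exact (hv j).2 (hmono (i + 1) j hlt _ (h _ hj))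
    · exact h _ hi (hv i).1
  let U : Ultrafilter (Fin m → M) := Ultrafilter.of (Filter.generate S)
  refine ⟨{χ | ∀ᶠ v in (U : Filter (Fin m → M)), χ.Realize v}, fun s hs => ?_, ?_⟩
  · exact ((Filter.eventually_all_finset s).2 fun χ hχ => hs hχ).exists
  · rintro θ ⟨v, hv⟩
    by_contra! hc
    by_cases hθ : atom θ
    · refine hc θ.not ?_ v hv hv
      have : ∀ᶠ v in (U : Filter (Fin m → M)), ¬ θ.Realize v :=
        Ultrafilter.of_le _ (Filter.GenerateSets.basic ⟨θ, hθ, rfl⟩)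
      exact this.mono fun v hv => Formula.realize_not.2 hv
    · simp only [atom, not_forall, not_or] at hθ
      obtain ⟨χ, ⟨v₁, hv₁, h₁⟩, v₂, hv₂, h₂⟩ := hθ
      rw [not_not] at h₂
      rcases Ultrafilter.em U (fun v => χ.Realize v) with h | h
      · exact h₁ (hc χ h v₁ hv₁)
      · exact (Formula.realize_not.1 (hc χ.not (by simpa [Formula.realize_not] using h) v₂ hv₂)) h₂

/-- The Henkin property of a set of formulas whose variables are thought of as constants. -/
theorem exists_generic_formulas [Countable Λ.Symbols] [Nonempty M] {m : ℕ}
    (p : Set (Λ.Formula (Fin m)))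
    (hp : ∀ θ : Λ.Formula (Fin m), (∃ v : Fin m → M, θ.Realize v) →
        ∃ χ ∈ p, ∃ v : Fin m → M, θ.Realize v ∧ ¬ χ.Realize v) :
    ∃ Γ : Set (Λ.Formula ℕ),
      (∀ s : Finset (Λ.Formula ℕ), ↑s ⊆ Γ → ∃ v : ℕ → M, ∀ χ ∈ s, χ.Realize v) ∧
      (∀ ψ : Λ.Formula (ℕ ⊕ Fin 1), (ψ.iExs (Fin 1)).not ∈ Γ ∨
        ∃ i : ℕ, ψ.relabel (Sum.elim id fun _ => i) ∈ Γ) ∧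
      ∀ i : Fin m → ℕ, ∃ χ ∈ p, (χ.relabel i).not ∈ Γ := by
  classical
  -- Forcing with nonempty definable sets, smaller ones being stronger: `D₁` secures Henkin
  -- witnesses, `D₂` makes each tuple of variables omit `p`.
  let P := {s : Set (ℕ → M) // s.Nonempty ∧ ∃ θ : Λ.Formula ℕ, s = {v | θ.Realize v}}
  let P' := Pᵒᵈ
  let D₁ : Λ.Formula (ℕ ⊕ Fin 1) → Order.Cofinal P' := fun ψ =>
    { carrier := {s | (∀ v ∈ s.1, (ψ.iExs (Fin 1)).not.Realize v) ∨
        ∃ i : ℕ, ∀ v ∈ s.1, (ψ.relabel (Sum.elim id fun _ => i)).Realize v}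
      isCofinal := by
        rintro ⟨_, hne, θ, rfl⟩
        by_cases h : ∀ v ∈ {v : ℕ → M | θ.Realize v}, (ψ.iExs (Fin 1)).not.Realize v
        · exact ⟨⟨_, hne, θ, rfl⟩, Or.inl h, le_rfl⟩
        · push Not at h
          obtain ⟨v, hv, h⟩ := h
          rw [Formula.realize_not, not_not, Formula.realize_iExs] at h
          obtain ⟨b, hb⟩ := h
          -- A fresh variable can be given the witness as value without disturbing `θ` or `ψ`.
          obtain ⟨i, hi⟩ := Infinite.exists_notMem_finset
            (θ.freeVarFinset ∪ ψ.freeVarFinset.toLeft)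
          simp only [Finset.mem_union, not_or] at hi
          have h1 : θ.Realize (Function.update v i (b 0)) := by
            refine (θ.realize_congr_of_eqOn fun a ha => ?_).1 hv
            rw [Function.update_of_ne]
            rintro rfl
            exact hi.1 ha
          have h2 : (ψ.relabel (Sum.elim id fun _ => i)).Realize (Function.update v i (b 0)) := by
            rw [Formula.realize_relabel]
            refine (ψ.realize_congr_of_eqOn fun a ha => ?_).1 hb
            rcases a with a | a
            · simp only [Sum.elim_inl, Function.comp_apply, id]
              rw [Function.update_of_ne]
              rintro rfl
              exact hi.2 (by simpa using ha)
            · simp [Subsingleton.elim a 0]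
          refine ⟨⟨{v | (θ ⊓ ψ.relabel (Sum.elim id fun _ => i)).Realize v}, ?_, _, rfl⟩, ?_, ?_⟩
          · exact ⟨_, Formula.realize_inf.2 ⟨h1, h2⟩⟩
          · exact Or.inr ⟨i, fun v hv => (Formula.realize_inf.1 hv).2⟩
          · exact fun v hv => (Formula.realize_inf.1 hv).1 }
  let D₂ : (Fin m → ℕ) → Order.Cofinal P' := fun i =>
    { carrier := {s | ∃ χ ∈ p, ∀ v ∈ s.1, (χ.relabel i).not.Realize v}
      isCofinal := by
        rintro ⟨_, ⟨v, hv⟩, θ, rfl⟩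
        obtain ⟨K₀, hK₀⟩ := θ.exists_support_bound (M := M)
        let K := K₀ + Finset.univ.sup i
        have hiK : ∀ j, i j ≤ K := fun j =>
          (Finset.le_sup (f := i) (Finset.mem_univ j)).trans (Nat.le_add_left _ _)
        let g : ℕ → Fin (K + 1) := fun n => ⟨min n K, by omega⟩
        have hg : ∀ n ≤ K, (g n : ℕ) = n := fun n hn => min_eq_left hn
        -- Quantifying out the variables of index at most `K` projects the condition to the
        -- coordinates `i`; as `p` is not isolated, the projection is compatible with the negation
        -- of some `χ ∈ p`.
        let θ' : Λ.Formula (Fin m ⊕ Fin (K + 1)) := θ.relabel (Sum.inr ∘ g) ⊓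
          Formula.iInf fun j : Fin m =>
            (Term.var (Sum.inr (g (i j)))).equal (Term.var (Sum.inl j))
        have hθ' : ∀ (y : Fin m → M) (x : Fin (K + 1) → M), θ'.Realize (Sum.elim y x) ↔
            θ.Realize (x ∘ g) ∧ ∀ j, x (g (i j)) = y j := fun y x => by
          simp only [θ', Formula.realize_inf, Formula.realize_relabel, Formula.realize_iInf,
            Formula.realize_equal, Term.realize_var, Sum.elim_inl, Sum.elim_inr]
          rfl
        obtain ⟨χ, hχ, y, hy, hyχ⟩ := hp (θ'.iExs (Fin (K + 1))) ⟨v ∘ i, by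
          rw [Formula.realize_iExs]
          refine ⟨fun n => v n, (hθ' _ _).2 ⟨(hK₀ _ _ fun n hn => ?_).1 hv, fun j => ?_⟩⟩
          · exact congrArg v (hg n (by omega)).symm
          · exact congrArg v (hg _ (hiK j))⟩
        rw [Formula.realize_iExs] at hy
        obtain ⟨x, hx⟩ := hy
        obtain ⟨h1, h2⟩ := (hθ' y x).1 hx
        refine ⟨⟨{v | (θ ⊓ (χ.relabel i).not).Realize v}, ⟨x ∘ g, ?_⟩, _, rfl⟩, ?_, ?_⟩
        · refine Formula.realize_inf.2 ⟨h1, ?_⟩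
          rw [Formula.realize_not, Formula.realize_relabel]
          rwa [show (x ∘ g) ∘ i = y from funext h2]
        · exact ⟨χ, hχ, fun v hv => (Formula.realize_inf.1 hv).2⟩
        · exact fun v hv => (Formula.realize_inf.1 hv).1 }
  let start : P' := ⟨Set.univ, Set.univ_nonempty, ⊤, by ext; simp⟩
  have : Encodable (Λ.Formula (ℕ ⊕ Fin 1) ⊕ (Fin m → ℕ)) := Encodable.ofCountable _
  let seq : ℕ → P' := Order.sequenceOfCofinals start (Sum.elim D₁ D₂)
  have hseq : ∀ i j, i ≤ j → (seq j).1 ⊆ (seq i).1 := fun i j hij =>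
    Order.sequenceOfCofinals.monotone start (Sum.elim D₁ D₂) hij
  refine ⟨{χ | ∃ k, ∀ v ∈ (seq k).1, χ.Realize v}, fun s hs => ?_, fun ψ => ?_, fun i => ?_⟩
  · choose! k hk using hs
    obtain ⟨v, hv⟩ := (seq (s.sup k)).2.1
    exact ⟨v, fun χ hχ => hk hχ v (hseq _ _ (Finset.le_sup hχ) hv)⟩
  · rcases Order.sequenceOfCofinals.encode_mem start (Sum.elim D₁ D₂) (Sum.inl ψ) with h | ⟨i, h⟩
    · exact Or.inl ⟨_, h⟩
    · exact Or.inr ⟨i, _, h⟩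
  · obtain ⟨χ, hχ, h⟩ :=
      Order.sequenceOfCofinals.encode_mem start (Sum.elim D₁ D₂) (Sum.inr i)
    exact ⟨χ, hχ, _, h⟩

/-- A sequence all of whose values form an elementary substructure, by the Tarski–Vaught test. -/
theorem exists_elementarySubstructure_range {N : Type*} [Λ.Structure N] (c : ℕ → N)
    (hc : ∀ ψ : Λ.Formula (ℕ ⊕ Fin 1), (∃ b : Fin 1 → N, ψ.Realize (Sum.elim c b)) →
      ∃ i : ℕ, ψ.Realize (Sum.elim c fun _ => c i)) :
    ∃ S : Λ.ElementarySubstructure N, ∀ x, x ∈ S ↔ x ∈ Set.range c := by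
  let S : Λ.Substructure N :=
    { carrier := Set.range c
      fun_mem := by
        intro n f x hx
        choose i hi using hx
        obtain ⟨k, hk⟩ := hc ((Term.func f fun j => Term.var (Sum.inl (i j))).equal
          (Term.var (Sum.inr 0))) ⟨fun _ => Structure.funMap f x, by
            simp [Formula.realize_equal, Term.realize_func, hi]⟩
        refine ⟨k, ?_⟩
        simpa [Formula.realize_equal, Term.realize_func, hi] using hk.symm }
  refine ⟨⟨S, S.isElementary_of_exists fun n φ x a ha => ?_⟩, fun x => Iff.rfl⟩
  choose i hi using fun j => (x j).2
  let g : Empty ⊕ Fin (n + 1) → ℕ ⊕ Fin 1 :=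
    Sum.elim Empty.elim (Fin.lastCases (Sum.inr 0) fun j => Sum.inl (i j))
  have hg : ∀ b : Fin 1 → N, (φ.toFormula.relabel g).Realize (Sum.elim c b) ↔
      φ.Realize default (Fin.snoc (Subtype.val ∘ x) (b 0) : Fin (n + 1) → N) := by
    intro b
    rw [Formula.realize_relabel, BoundedFormula.realize_toFormula]
    have e : (Sum.elim c b ∘ g) ∘ Sum.inr =
        (Fin.snoc (Subtype.val ∘ x) (b 0) : Fin (n + 1) → N) := by
      funext j
      induction j using Fin.lastCases with
      | last => simp [g]
      | cast j => simp [g, hi]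
    rw [e, Subsingleton.elim ((Sum.elim c b ∘ g) ∘ Sum.inl) default]
  obtain ⟨k, hk⟩ := hc (φ.toFormula.relabel g) ⟨fun _ => a, (hg _).2 ha⟩
  exact ⟨⟨c k, k, rfl⟩, (hg _).1 hk⟩

/-- If the theory of an infinite structure in a countable language is `ℵ₀`-categorical, then there
is no strictly increasing sequence of definable sets of `m`-tuples. -/
theorem not_strictMono_definable_of_categorical [Countable Λ.Symbols] [Infinite M]
    (hcat : Categorical aleph0.{0} (Λ.completeTheory M)) {m : ℕ} (φ : ℕ → Λ.Formula (Fin m))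
    (hmono : ∀ i j, i ≤ j → ∀ v : Fin m → M, (φ i).Realize v → (φ j).Realize v)
    (hlt : ∀ i, ∃ v : Fin m → M, (φ (i + 1)).Realize v ∧ ¬ (φ i).Realize v) : False := by
  obtain ⟨p, hp, hiso⟩ := exists_nonisolated_type φ hmono hlt
  obtain ⟨N₁, v, hN₁, hv⟩ := exists_countable_model_realize (M := M) p hp
  obtain ⟨Γ, hΓ, hhenkin, homit⟩ := exists_generic_formulas p hiso
  obtain ⟨N₂, c, hN₂, hc⟩ := exists_countable_model_realize (M := M) Γ hΓ
  obtain ⟨S, hS⟩ := exists_elementarySubstructure_range c fun ψ hψ => by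
    rcases hhenkin ψ with h | ⟨i, h⟩
    · exact absurd (Formula.realize_iExs.2 hψ) (Formula.realize_not.1 (hc _ h))
    · refine ⟨i, ?_⟩
      have := Formula.realize_relabel.1 (hc _ h)
      convert this using 1
      ext (a | a) <;> simp
  have hinf : Infinite S := by
    have : M ≅[Λ] S := (completeTheory.isComplete Λ M).models_elementarily_equivalent M S
    exact this.infinite
  have hcount : Countable S := by
    have : (S : Set N₂) = Set.range c := Set.ext hS
    have h : (S : Set N₂).Countable := this ▸ Set.countable_range c
    exact h.to_subtype
  -- `N₁` realizes `p` while `S`, whose elements are all values of `c`, omits it.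
  obtain ⟨e⟩ : Nonempty (N₁ ≃[Λ] S) :=
    hcat N₁ (Theory.ModelType.of _ S) hN₁ (mk_eq_aleph0 S)
  choose i hi using fun j => (hS (e (v j)).1).1 (e (v j)).2
  obtain ⟨χ, hχ, h⟩ := homit i
  have h1 : χ.Realize fun j => (e (v j)).1 := by
    have := (S.subtype.map_formula χ (e ∘ v)).2 ((StrongHomClass.realize_formula e χ).2 (hv χ hχ))
    exact this
  have h2 := Formula.realize_not.1 (hc _ h)
  rw [Formula.realize_relabel, show c ∘ i = _ from funext hi] at h2
  exact h2 h1

end OmegaCategorical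

/-! ### Definability of Engel chains and the `ω`-categorical case. -/

section LieRingLanguage

open FirstOrder.Language
open scoped FirstOrder

instance : Countable lieRingLanguage.Symbols := by
  have : ∀ n, Countable (lieRingLanguage.Functions n) := fun n => by
    let code : lieRingLanguage.Functions n → ℕ := fun f =>
      match n, f with
      | _, LieRingFunc.zero => 0
      | _, LieRingFunc.add => 1
      | _, LieRingFunc.bracket => 2
    refine ⟨code, fun f g h => ?_⟩
    cases f <;> cases g <;> first | rfl | simp [code] at h
  have : ∀ n, Countable (lieRingLanguage.Relations n) := fun n =>
    inferInstanceAs (Countable Empty)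
  exact inferInstanceAs (Countable ((Σ n, lieRingLanguage.Functions n) ⊕
    Σ n, lieRingLanguage.Relations n))

/-- The bracket of two terms in the language of Lie rings. -/
def lieTerm {α : Type*} (s t : lieRingLanguage.Term α) : lieRingLanguage.Term α :=
  Term.func (l := 2) LieRingFunc.bracket ![s, t]

/-- The term `0` in the language of Lie rings. -/
def zeroTerm {α : Type*} : lieRingLanguage.Term α :=
  Term.func (l := 0) LieRingFunc.zero ![]

variable {L : Type*} [LieRing L]

theorem realize_lieTerm {α : Type*} (s t : lieRingLanguage.Term α) (v : α → L) :
    (lieTerm s t).realize v = ⁅s.realize v, t.realize v⁆ := rfl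

theorem realize_zeroTerm {α : Type*} (v : α → L) :
    (zeroTerm : lieRingLanguage.Term α).realize v = 0 := rfl

theorem exists_formula_engelChain (n : ℕ) : ∃ φ : lieRingLanguage.Formula (Fin 4),
    ∀ v : Fin 4 → L, φ.Realize v ↔ EngelChain (v 0) (v 1) (v 2) n (v 3) := by
  let δ : lieRingLanguage.Formula (Fin 4) := ((Term.var (Sum.inl 3)).equal
    (lieTerm (lieTerm (Term.var (Sum.inl 2)) (Term.var (Sum.inr 0)))
      (Term.var (Sum.inr 0)))).iExs (Fin 1)
  have hδ : ∀ v : Fin 4 → L, δ.Realize v ↔ ∃ a, v 3 = ⁅⁅v 2, a⁆, a⁆ := fun v => by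
    rw [Formula.realize_iExs]
    simp only [Formula.realize_equal, realize_lieTerm, Term.realize_var, Sum.elim_inl,
      Sum.elim_inr]
    exact ⟨fun ⟨b, hb⟩ => ⟨b 0, hb⟩, fun ⟨a, ha⟩ => ⟨fun _ => a, ha⟩⟩
  induction n with
  | zero =>
    refine ⟨δ ⊓ (lieTerm (Term.var 3) (Term.var 0)).equal zeroTerm, fun v => ?_⟩
    rw [Formula.realize_inf, hδ, Formula.realize_equal]
    rfl
  | succ n ih =>
    obtain ⟨φ, hφ⟩ := ih
    refine ⟨δ ⊓ ((φ.relabel ![Sum.inl 0, Sum.inl 1, Sum.inl 2, Sum.inr 0]) ⊓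
      (lieTerm (Term.var (Sum.inr 0)) (Term.var (Sum.inl 1))).equal
        (lieTerm (Term.var (Sum.inl 3)) (Term.var (Sum.inl 0)))).iExs (Fin 1), fun v => ?_⟩
    rw [Formula.realize_inf, hδ, Formula.realize_iExs]
    simp only [Formula.realize_inf, Formula.realize_relabel, hφ, Formula.realize_equal]
    exact and_congr_right fun _ =>
      ⟨fun ⟨b, hb, e⟩ => ⟨b 0, hb, e⟩, fun ⟨f', hf', e⟩ => ⟨fun _ => f', hf', e⟩⟩

theorem IsOmegaCategorical.isNilpotent_of_isNEngel (hcat : IsOmegaCategorical L)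
    (h : IsNEngel 3 L) (h5 : ∀ x : L, (5 : ℤ) • x = 0) : LieRing.IsNilpotent L := by
  -- For finite `L` categoricity is vacuous, but there are only finitely many quadruples.
  rcases finite_or_infinite L with hfin | hinf
  · refine h.isNilpotent_of_hasFinitelyManyAutOrbits h5 ?_
    unfold HasFinitelyManyAutOrbits
    infer_instance
  · by_contra hL
    choose φ hφ using exists_formula_engelChain (L := L)
    refine not_strictMono_definable_of_categorical (M := L) hcat φ (fun i j hij v hv => ?_)
      fun i => ?_
    · exact (hφ j v).2 (((hφ i v).1 hv).mono hij)
    · obtain ⟨y₁, y₂, z, f, h1, h2⟩ := h.exists_engelChain h5 hL i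
      exact ⟨![y₁, y₂, z, f], (hφ _ _).2 h1, fun hc => h2 ((hφ _ _).1 hc)⟩

end LieRingLanguage

theorem mainTheorem1 :
    -- automorphisms of `L` as a Lie algebra over `K`
    (∀ (K : Type*) (L : Type*) [Field K] [CharP K 5] [LieRing L] [LieAlgebra K L],
      IsNEngel 3 L → HasFinitelyManyAutOrbits K L 4 → LieRing.IsNilpotent L) ∧
    -- automorphisms of `L` as a Lie ring
    (∀ (K : Type*) (L : Type*) [Field K] [CharP K 5] [LieRing L] [LieAlgebra K L],
      IsNEngel 3 L → HasFinitelyManyAutOrbits ℤ L 4 → LieRing.IsNilpotent L) ∧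
    -- the `ω`-categorical case
    (∀ (L : Type*) [LieRing L] [LieAlgebra (ZMod 5) L],
      IsOmegaCategorical L → (∀ x y : L, ⁅⁅⁅x, y⁆, y⁆, y⁆ = 0) → LieRing.IsNilpotent L) := by
  have : Fact (Nat.Prime 5) := ⟨by norm_num⟩
  refine ⟨?_, ?_, ?_⟩
  · intro K L _ _ _ _ h hfin
    exact h.isNilpotent_of_hasFinitelyManyAutOrbits (zsmul_five_eq_zero K)
      hfin.restrictScalars_int
  · intro K L _ _ _ _ h hfin
    exact h.isNilpotent_of_hasFinitelyManyAutOrbits (zsmul_five_eq_zero K) hfin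
  · intro L _ _ hcat h
    exact hcat.isNilpotent_of_isNEngel (fun a b => h a b) (zsmul_five_eq_zero (ZMod 5))
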